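/- **Conventions.** A cone is a commutative monoid $C$ with a scalar multiplication by $\mathbb R_+=[0,\infty)$ satisfying the usual axioms $r(x+y)=rx+ry$, $(r+s)x=rx+sx$, $(rs)x=r(sx)$, $1x=x$, $0x=0$, $r0=0$. A topological cone is a cone with a $T_0$ topology for which addition and scalar multiplication are jointly continuous, $\mathbb R_+$ carrying the Scott topology; it is weakly locally convex if every open neighbourhood of every point $x$ contains a convex (not necessarily open) neighbourhood of $x$. A map $f$ between cones is linear if $f(rx+sy)=rf(x)+sf(y)$ for all $r,s\in\mathbb R_+$ and all $x,y$. For a topological space $X$ with lattice of open sets $\mathcal O X$, a point-continuous valuation is a map $\mu:\mathcal O X\to[0,\infty]$ with $\mu(\emptyset)=0$, $\mu(U)\le\mu(V)$ for $U\subseteq V$, and $\mu(U)+\mu(V)=\mu(U\cup V)+\mu(U\cap V)$, which is continuous when $\mathcal O X$ has the topology generated by the sets $\{U : x\in U\}$, $x\in X$, and $[0,\infty]$ has the Scott topology. $\mathcal V_{\mathrm p}X$ is the set of these valuations with the topology generated by the sets $\{\mu : \mu(U)>r\}$, $U$ open, $r\in\mathbb R_+$. Sums and scalar multiples of valuations are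 taken pointwise. For continuous $f:X\to Y$, $\mathcal V_{\mathrm p}f(\mu)(U)=\mu(f^{-1}(U))$. The unit is $x\mapsto\delta_x$ (Dirac masses), and the multiplication $m_X:\mathcal V_{\mathrm p}\mathcal V_{\mathrm p}X\to\mathcal V_{\mathrm p}X$ is $m_X(\Pi)(U)=\int\nu(U)\,d\Pi(\nu)$, where $\int h\,d\mu=\int_0^\infty\mu(\{h>r\})\,dr$ for lower semicontinuous $h$. A $\mathcal V_{\mathrm p}$-algebra is a $T_0$ space $X$ with a continuous map $\alpha:\mathcal V_{\mathrm p}X\to X$ such that $\alpha(\delta_x)=x$ for all $x\in X$ and $\alpha\circ m_X=\alpha\circ\mathcal V_{\mathrm p}\alpha$. It induces the operations $x+y=\alpha(\delta_x+\delta_y)$ and $r\cdot x=\alpha(r\delta_x)$ on $X$. A continuous map $f:X\to Y$ is a morphism of algebras $(X,\alpha)\to(Y,\beta)$ if $f\circ\alpha=\beta\circ\mathcal V_{\mathrm p}f$. **Theorem.** Let $X$ and $Y$ be weakly locally convex sober topological cones, and let $\alpha:\mathcal V_{\mathrm p}X\to X$ and $\beta:\mathcal V_{\mathrm p}Y\to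 Y$ be the structure maps of the corresponding $\mathcal V_{\mathrm p}$-algebras, that is, of $\mathcal V_{\mathrm p}$-algebras on the spaces $X$ and $Y$ that induce the given cone operations. Then a continuous map $f:X\to Y$ is a $\mathcal V_{\mathrm p}$-algebra morphism if and only if $f$ is linear. -/

import Mathlib

open Set TopologicalSpace
open scoped NNReal ENNReal

noncomputable section

/-! ### Point-continuous valuations -/

/-- The point topology on the lattice of open sets of `X`, generated by the sets
`O(x) = {U | x ∈ U}` for `x : X`. -/
@[reducible] def pointTopology (X : Type*) [TopologicalSpace X] : TopologicalSpace (Opens X) :=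
  TopologicalSpace.generateFrom {S | ∃ x : X, S = {U : Opens X | x ∈ U}}

/-- A point-continuous valuation on `X`: a strict, monotone, modular map from the open sets to
`[0, ∞]` which is continuous from the point topology to the Scott topology of `[0, ∞]`, that is,
lower semicontinuous for the point topology. -/
@[ext]
structure PointContinuousValuation (X : Type*) [TopologicalSpace X] where
  toFun : Opens X → ℝ≥0∞
  strict' : toFun ⊥ = 0
  mono' : Monotone toFun
  modular' : ∀ U V : Opens X, toFun U + toFun V = toFun (U ⊔ V) + toFun (U ⊓ V)
  pointContinuous' : @LowerSemicontinuous (Opens X) ℝ≥0∞ (pointTopology X) _ toFun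

namespace PointContinuousValuation

variable {X Y : Type*} [TopologicalSpace X] [TopologicalSpace Y]

instance : CoeFun (PointContinuousValuation X) (fun _ => Opens X → ℝ≥0∞) := ⟨toFun⟩

/-- The weak topology, generated by the sets `[U > r] = {μ | μ U > r}` for `U` open and
`r ∈ [0, ∞)`. -/
instance : TopologicalSpace (PointContinuousValuation X) :=
  TopologicalSpace.generateFrom
    {S | ∃ (U : Opens X) (r : ℝ≥0),
      S = {μ : PointContinuousValuation X | (r : ℝ≥0∞) < μ U}}

lemma pointContinuous_iff (m : Opens X → ℝ≥0∞) :
    @LowerSemicontinuous (Opens X) ℝ≥0∞ (pointTopology X) _ m ↔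
      ∀ (U : Opens X) (r : ℝ≥0∞), r < m U →
        ∃ F : Set X, F.Finite ∧ F ⊆ U ∧ ∀ V : Opens X, F ⊆ V → r < m V := by
  let _ := pointTopology X
  constructor
  · intro h U r hr
    obtain ⟨t, hts, hto, hUt⟩ := mem_nhds_iff.1 (h U r hr)
    have key : ∀ t : Set (Opens X),
        TopologicalSpace.GenerateOpen {S | ∃ x : X, S = {U : Opens X | x ∈ U}} t → U ∈ t →
        ∃ F : Set X, F.Finite ∧ F ⊆ U ∧ ∀ V : Opens X, F ⊆ V → V ∈ t := by
      intro t ht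
      induction ht with
      | basic s hs =>
        obtain ⟨x, rfl⟩ := hs
        intro hU
        exact ⟨{x}, Set.finite_singleton x, by simpa using hU, fun V hV => hV rfl⟩
      | univ => exact fun _ => ⟨∅, Set.finite_empty, Set.empty_subset _, fun _ _ => trivial⟩
      | inter s t _ _ ihs iht =>
        rintro ⟨h1, h2⟩
        obtain ⟨F, hF, hFU, hFs⟩ := ihs h1
        obtain ⟨G, hG, hGU, hGt⟩ := iht h2
        exact ⟨F ∪ G, hF.union hG, Set.union_subset hFU hGU, fun V hV =>
          ⟨hFs V (Set.subset_union_left.trans hV), hGt V (Set.subset_union_right.trans hV)⟩⟩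
      | sUnion S _ ih =>
        rintro ⟨s, hs, hU⟩
        obtain ⟨F, hF, hFU, hFs⟩ := ih s hs hU
        exact ⟨F, hF, hFU, fun V hV => ⟨s, hs, hFs V hV⟩⟩
    obtain ⟨F, hF, hFU, hFt⟩ := key t hto hUt
    exact ⟨F, hF, hFU, fun V hV => hts (hFt V hV)⟩
  · intro h U r hr
    obtain ⟨F, hF, hFU, hFV⟩ := h U r hr
    have ho : IsOpen (⋂ x ∈ F, {V : Opens X | x ∈ V}) :=
      hF.isOpen_biInter fun x _ => TopologicalSpace.isOpen_generateFrom_of_mem ⟨x, rfl⟩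
    refine Filter.mem_of_superset (ho.mem_nhds ?_) ?_
    · simp only [Set.mem_iInter]
      exact fun x hx => hFU hx
    · intro V hV
      simp only [Set.mem_iInter] at hV
      exact hFV V fun x hx => hV x hx

lemma exists_finite (μ : PointContinuousValuation X) {U : Opens X} {r : ℝ≥0∞} (h : r < μ U) :
    ∃ F : Set X, F.Finite ∧ F ⊆ U ∧ ∀ V : Opens X, F ⊆ V → r < μ V :=
  (pointContinuous_iff _).1 μ.pointContinuous' U r h

open Classical in
/-- The Dirac mass `δ_x`. -/
def dirac (x : X) : PointContinuousValuation X where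
  toFun U := if x ∈ U then 1 else 0
  strict' := by simp
  mono' := by
    intro U V h
    by_cases hU : x ∈ U
    · simp [hU, h hU]
    · simp [hU]
  modular' := by
    intro U V
    by_cases hU : x ∈ U <;> by_cases hV : x ∈ V <;> simp [hU, hV]
  pointContinuous' := by
    rw [pointContinuous_iff]
    intro U r hr
    by_cases hU : x ∈ U
    · refine ⟨{x}, Set.finite_singleton x, by simpa using hU, fun V hV => ?_⟩
      have hV' : x ∈ V := hV rfl
      simpa [hU, hV'] using hr
    · simp [hU] at hr

/-- The sum `μ + ν`, computed on each open set. -/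
instance : Add (PointContinuousValuation X) where
  add μ ν :=
    { toFun := fun U => μ U + ν U
      strict' := by simp [μ.strict', ν.strict']
      mono' := fun U V h => add_le_add (μ.mono' h) (ν.mono' h)
      modular' := fun U V => by
        rw [add_add_add_comm, μ.modular' U V, ν.modular' U V, add_add_add_comm]
      pointContinuous' := by
        let _ := pointTopology X
        exact μ.pointContinuous'.add ν.pointContinuous' }

/-- The scalar multiple `r • μ` for `r ∈ [0, ∞)`, computed on each open set. -/
instance : SMul ℝ≥0 (PointContinuousValuation X) where
  smul r μ :=
    { toFun := fun U => (r : ℝ≥0∞) * μ U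
      strict' := by simp [μ.strict']
      mono' := fun U V h => mul_le_mul_right (μ.mono' h) _
      modular' := fun U V => by rw [← mul_add, μ.modular' U V, mul_add]
      pointContinuous' := by
        let _ := pointTopology X
        exact (ENNReal.continuous_const_mul ENNReal.coe_ne_top).comp_lowerSemicontinuous
          μ.pointContinuous' (fun a b h => mul_le_mul_right h _) }

/-- The image `V_p f (μ) = (U ↦ μ (f⁻¹ U))` of a point-continuous valuation under a continuous
map. -/
def map (f : C(X, Y)) (μ : PointContinuousValuation X) : PointContinuousValuation Y where
  toFun U := μ (U.comap f)
  strict' := by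
    have h : (⊥ : Opens Y).comap f = ⊥ := by ext; simp
    rw [h, μ.strict']
  mono' := fun U V h => μ.mono' (fun x hx => h hx)
  modular' := fun U V => μ.modular' (U.comap f) (V.comap f)
  pointContinuous' := by
    rw [pointContinuous_iff]
    intro U r hr
    obtain ⟨F, hF, hFU, hFV⟩ := μ.exists_finite hr
    refine ⟨f '' F, hF.image f, ?_, fun V hV => hFV _ ?_⟩
    · rintro _ ⟨x, hx, rfl⟩
      exact hFU hx
    · exact fun x hx => hV ⟨x, hx, rfl⟩

/-! ### Integration of lower semicontinuous functions -/

/-- The open set `{x | r < h x}`, for `h` lower semicontinuous. -/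
def superlevel (h : X → ℝ≥0∞) (hh : LowerSemicontinuous h) (r : ℝ≥0∞) : Opens X :=
  ⟨{x | r < h x}, hh.isOpen_preimage r⟩

/-- The integral `∫ h dμ = ∫₀^∞ μ {x | h x > r} dr` of a lower semicontinuous function `h`. -/
def integral (μ : PointContinuousValuation X) (h : X → ℝ≥0∞) (hh : LowerSemicontinuous h) :
    ℝ≥0∞ :=
  ∫⁻ r in Ioi (0 : ℝ), μ (superlevel h hh (ENNReal.ofReal r))

lemma lowerSemicontinuous_eval (U : Opens X) :
    LowerSemicontinuous (fun ν : PointContinuousValuation X => ν U) := by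
  intro ν r hr
  lift r to ℝ≥0 using ne_top_of_lt hr
  exact IsOpen.mem_nhds (TopologicalSpace.isOpen_generateFrom_of_mem ⟨U, r, rfl⟩) hr

lemma superlevel_mono {f g : X → ℝ≥0∞} (hf : LowerSemicontinuous f) (hg : LowerSemicontinuous g)
    (h : f ≤ g) {r s : ℝ≥0∞} (hrs : s ≤ r) : superlevel f hf r ≤ superlevel g hg s :=
  fun x (hx : r < f x) => (hrs.trans_lt hx).trans_le (h x)

lemma integral_mono (μ : PointContinuousValuation X) {f g : X → ℝ≥0∞}
    (hf : LowerSemicontinuous f) (hg : LowerSemicontinuous g) (h : f ≤ g) :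
    μ.integral f hf ≤ μ.integral g hg :=
  MeasureTheory.lintegral_mono fun _ => μ.mono' (superlevel_mono hf hg h le_rfl)

lemma antitone_level (μ : PointContinuousValuation X) (f : X → ℝ≥0∞)
    (hf : LowerSemicontinuous f) :
    Antitone (fun r : ℝ => μ (superlevel f hf (ENNReal.ofReal r))) :=
  fun _ _ h => μ.mono' (superlevel_mono hf hf le_rfl (ENNReal.ofReal_le_ofReal h))

lemma eq_iSup_of_monotone (μ : PointContinuousValuation X) (U : Opens X) (V : ℕ → Opens X)
    (hV : Monotone V) (hU : (U : Set X) = ⋃ n, (V n : Set X)) : μ U = ⨆ n, μ (V n) := by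
  apply le_antisymm
  · refine le_of_forall_lt fun r hr => ?_
    obtain ⟨F, hF, hFU, hFV⟩ := μ.exists_finite hr
    rw [hU] at hFU
    obtain ⟨n, hn⟩ := hV.directed_le.exists_mem_subset_of_finset_subset_biUnion
      (s := hF.toFinset) (f := fun n => (V n : Set X)) (by simpa using hFU)
    exact (hFV (V n) (by simpa using hn)).trans_le (le_iSup (fun n => μ (V n)) n)
  · refine iSup_le fun n => μ.mono' fun x hx => ?_
    have : x ∈ (U : Set X) := hU ▸ Set.mem_iUnion.2 ⟨n, hx⟩
    exact this

lemma integral_iSup (μ : PointContinuousValuation X) (f : X → ℝ≥0∞) (hf : LowerSemicontinuous f)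
    (g : ℕ → X → ℝ≥0∞) (hg : ∀ n, LowerSemicontinuous (g n)) (hmono : Monotone g)
    (hfg : ∀ x, f x = ⨆ n, g n x) :
    μ.integral f hf = ⨆ n, μ.integral (g n) (hg n) := by
  unfold integral
  rw [← MeasureTheory.lintegral_iSup (fun n => (antitone_level μ (g n) (hg n)).measurable)]
  · refine MeasureTheory.lintegral_congr fun r => ?_
    apply μ.eq_iSup_of_monotone
    · exact fun m n hmn => superlevel_mono _ _ (hmono hmn) le_rfl
    · ext x
      rw [mem_iUnion]
      change ENNReal.ofReal r < f x ↔ ∃ n, ENNReal.ofReal r < g n x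
      rw [hfg, lt_iSup_iff]
  · exact fun m n hmn r => μ.mono' (superlevel_mono _ _ (hmono hmn) le_rfl)

lemma lowerSemicontinuous_indicator (U : Opens X) (c : ℝ≥0∞) :
    LowerSemicontinuous ((U : Set X).indicator fun _ => c) :=
  U.isOpen.lowerSemicontinuous_indicator (by simp)

lemma integral_add_indicator (μ : PointContinuousValuation X) (f : X → ℝ≥0∞)
    (hf : LowerSemicontinuous f) (U : Opens X) (c : ℝ) (hc : 0 < c)
    (h : LowerSemicontinuous fun x => f x + (U : Set X).indicator (fun _ => ENNReal.ofReal c) x) :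
    μ.integral (fun x => f x + (U : Set X).indicator (fun _ => ENNReal.ofReal c) x) h =
      μ.integral f hf + ENNReal.ofReal c * μ U := by
  set g : X → ℝ≥0∞ := fun x => f x + (U : Set X).indicator (fun _ => ENNReal.ofReal c) x with hg
  let K : ℝ → ℝ≥0∞ := fun r => μ (superlevel f hf (ENNReal.ofReal r) ⊓ U)
  have hKanti : Antitone K := fun r s hrs => μ.mono'
    (inf_le_inf_right _ (superlevel_mono hf hf le_rfl (ENNReal.ofReal_le_ofReal hrs)))
  have hKf : ∀ r, K r ≤ μ (superlevel f hf (ENNReal.ofReal r)) := fun r => μ.mono' inf_le_left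
  let G : ℝ → ℝ≥0∞ := fun r => if r < c then μ U else K (r - c)
  have hpt : ∀ r ∈ Ioi (0 : ℝ), μ (superlevel g h (ENNReal.ofReal r)) + K r =
      μ (superlevel f hf (ENNReal.ofReal r)) + G r := by
    intro r hr
    have hr : 0 < r := hr
    by_cases hrc : r < c
    · have e : superlevel g h (ENNReal.ofReal r) = superlevel f hf (ENNReal.ofReal r) ⊔ U := by
        ext x
        change ENNReal.ofReal r < g x ↔ ENNReal.ofReal r < f x ∨ x ∈ U
        by_cases hx : x ∈ U
        · have : ENNReal.ofReal r < g x := by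
            simp only [hg, indicator_of_mem (SetLike.mem_coe.2 hx)]
            exact ((ENNReal.ofReal_lt_ofReal_iff hc).2 hrc).trans_le le_add_self
          simp [this, hx]
        · simp [hg, hx]
      simp only [G, if_pos hrc, K]
      rw [e, ← μ.modular']
    · have e : superlevel g h (ENNReal.ofReal r) = superlevel f hf (ENNReal.ofReal r) ⊔
          (superlevel f hf (ENNReal.ofReal (r - c)) ⊓ U) := by
        ext x
        change ENNReal.ofReal r < g x ↔
          ENNReal.ofReal r < f x ∨ (ENNReal.ofReal (r - c) < f x ∧ x ∈ U)
        by_cases hx : x ∈ U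
        · have e1 : ENNReal.ofReal r = ENNReal.ofReal (r - c) + ENNReal.ofReal c := by
            rw [← ENNReal.ofReal_add (by linarith) hc.le]; simp
          have e2 : ENNReal.ofReal r < g x ↔ ENNReal.ofReal (r - c) < f x := by
            simp only [hg, indicator_of_mem (SetLike.mem_coe.2 hx)]
            rw [e1, ENNReal.add_lt_add_iff_right ENNReal.ofReal_ne_top]
          rw [e2]
          have e3 : ENNReal.ofReal r < f x → ENNReal.ofReal (r - c) < f x :=
            (ENNReal.ofReal_le_ofReal (by linarith)).trans_lt
          tauto
        · simp [hg, hx]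
      have e' : superlevel f hf (ENNReal.ofReal r) ⊓ U = superlevel f hf (ENNReal.ofReal r) ⊓
          (superlevel f hf (ENNReal.ofReal (r - c)) ⊓ U) := by
        rw [← inf_assoc, inf_eq_left.2
          (superlevel_mono hf hf le_rfl (ENNReal.ofReal_le_ofReal (by linarith)))]
      simp only [G, if_neg hrc, K]
      rw [e, e', ← μ.modular']
  have hGint : ∫⁻ r in Ioi (0 : ℝ), G r = ENNReal.ofReal c * μ U + ∫⁻ r in Ioi (0 : ℝ), K r := by
    have hsplit : Ioi (0 : ℝ) = Ioo 0 c ∪ Ici c := by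
      ext r
      simp only [mem_Ioi, mem_union, mem_Ioo, mem_Ici]
      constructor
      · intro hr
        rcases lt_or_ge r c with h | h
        · exact Or.inl ⟨hr, h⟩
        · exact Or.inr h
      · rintro (h | h)
        · exact h.1
        · linarith
    have hdisj : Disjoint (Ioo 0 c) (Ici c) :=
      Set.disjoint_left.2 fun r h1 h2 => absurd h1.2 (not_lt.2 h2)
    rw [hsplit, MeasureTheory.lintegral_union measurableSet_Ici hdisj, ← hsplit]
    congr 1
    · rw [MeasureTheory.setLIntegral_congr_fun (g := fun _ => μ U) measurableSet_Ioo
        (fun r hr => if_pos hr.2)]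
      simp [mul_comm]
    · rw [MeasureTheory.setLIntegral_congr_fun (g := fun r => K (r - c)) measurableSet_Ici
        (fun r hr => if_neg (not_lt.2 hr)),
        ← MeasureTheory.lintegral_indicator measurableSet_Ici]
      have : ((Ici c).indicator fun r => K (r - c)) = fun r => (Ici (0 : ℝ)).indicator K (r - c) := by
        ext r
        by_cases hr : c ≤ r
        · rw [indicator_of_mem (mem_Ici.2 hr), indicator_of_mem (mem_Ici.2 (by linarith))]
        · rw [indicator_of_notMem (by simpa using hr), indicator_of_notMem (by simpa using hr)]
      rw [this, MeasureTheory.lintegral_sub_right_eq_self (fun r => (Ici (0 : ℝ)).indicator K r) c,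
        MeasureTheory.lintegral_indicator measurableSet_Ici]
      exact (MeasureTheory.setLIntegral_congr MeasureTheory.Ioi_ae_eq_Ici).symm
  have hsum : μ.integral g h + ∫⁻ r in Ioi (0 : ℝ), K r =
      (μ.integral f hf + ENNReal.ofReal c * μ U) + ∫⁻ r in Ioi (0 : ℝ), K r := by
    rw [add_assoc, ← hGint]
    unfold integral
    rw [← MeasureTheory.lintegral_add_right _ hKanti.measurable,
      ← MeasureTheory.lintegral_add_left (antitone_level μ f hf).measurable]
    exact MeasureTheory.setLIntegral_congr_fun measurableSet_Ioi hpt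
  by_cases hfin : ∫⁻ r in Ioi (0 : ℝ), K r = ⊤
  · have h1 : μ.integral f hf = ⊤ := top_le_iff.1
      (hfin ▸ MeasureTheory.lintegral_mono hKf)
    have h2 : μ.integral g h = ⊤ := top_le_iff.1
      (h1 ▸ μ.integral_mono hf h fun x => le_self_add)
    rw [h1, h2, top_add]
  · exact (ENNReal.add_left_inj hfin).1 hsum

/-- The dyadic number `(k + 1) / 2 ^ n`. -/
def dyad (n k : ℕ) : ℝ := ((k : ℝ) + 1) / 2 ^ n

/-- The least multiple of `2 ^ (-n)` strictly above `r ≥ 0`. -/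
def dyadAbove (n : ℕ) (r : ℝ) : ℝ := dyad n ⌊r * 2 ^ n⌋₊

/-- The length of the set of all `r > 0` with `dyadAbove n r = dyad n k`. -/
def weight (n k : ℕ) : ℝ≥0∞ :=
  (MeasureTheory.volume.restrict (Ioi (0 : ℝ))).map (fun r : ℝ => ⌊r * 2 ^ n⌋₊) {k}

lemma lt_dyadAbove (n : ℕ) (r : ℝ) : r < dyadAbove n r := by
  unfold dyadAbove dyad
  rw [lt_div_iff₀ (by positivity)]
  exact Nat.lt_floor_add_one _

lemma dyadAbove_anti {r : ℝ} (hr : 0 < r) : Antitone fun n => dyadAbove n r := by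
  refine antitone_nat_of_succ_le fun n => ?_
  unfold dyadAbove dyad
  rw [pow_succ, div_le_div_iff₀ (by positivity) (by positivity)]
  have h1 : ⌊r * (2 ^ n * 2)⌋₊ < 2 * ⌊r * 2 ^ n⌋₊ + 2 := by
    rw [Nat.floor_lt (by positivity)]
    push_cast
    linarith [Nat.lt_floor_add_one (r * 2 ^ n)]
  have h2 : (⌊r * (2 ^ n * 2)⌋₊ : ℝ) + 1 ≤ 2 * ⌊r * 2 ^ n⌋₊ + 2 := by exact_mod_cast h1
  calc _ ≤ (2 * (⌊r * 2 ^ n⌋₊ : ℝ) + 2) * 2 ^ n := by gcongr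
    _ = _ := by ring

lemma exists_dyadAbove_lt {r s : ℝ} (hr : 0 < r) (hs : r < s) : ∃ n, dyadAbove n r < s := by
  obtain ⟨n, hn⟩ := exists_pow_lt_of_lt_one (sub_pos.2 hs) (by norm_num : (1 / 2 : ℝ) < 1)
  refine ⟨n, ?_⟩
  have h1 : (⌊r * 2 ^ n⌋₊ : ℝ) ≤ r * 2 ^ n := Nat.floor_le (by positivity)
  have h2 : ((1 / 2 : ℝ)) ^ n * 2 ^ n = 1 := by rw [← mul_pow]; norm_num
  have h3 : (1 / 2 : ℝ) ^ n * 2 ^ n < (s - r) * 2 ^ n := by gcongr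
  unfold dyadAbove dyad
  rw [div_lt_iff₀ (by positivity)]
  linarith

lemma weight_ne_top (n k : ℕ) : weight n k ≠ ⊤ := by
  have hm : Measurable fun r : ℝ => ⌊r * 2 ^ n⌋₊ :=
    Nat.measurable_floor.comp (measurable_id.mul_const _)
  unfold weight
  rw [MeasureTheory.Measure.map_apply hm (measurableSet_singleton k),
    MeasureTheory.Measure.restrict_apply (hm (measurableSet_singleton k))]
  refine ne_top_of_le_ne_top (b := MeasureTheory.volume (Ioo (0 : ℝ) (dyad n k))) (by simp) ?_
  refine MeasureTheory.measure_mono ?_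
  rintro r ⟨h1, h2⟩
  have h1 : ⌊r * 2 ^ n⌋₊ = k := h1
  exact ⟨h2, by simpa [dyadAbove, h1] using lt_dyadAbove n r⟩

lemma lintegral_eq_iSup_tsum (w : ℝ → ℝ≥0∞) (hw : Antitone w)
    (hw' : ∀ r, 0 < r → w r = ⨆ n, w (dyadAbove n r)) :
    ∫⁻ r in Ioi (0 : ℝ), w r = ⨆ n, ∑' k, w (dyad n k) * weight n k := by
  have hm : ∀ n : ℕ, Measurable fun r : ℝ => ⌊r * 2 ^ n⌋₊ := fun n =>
    Nat.measurable_floor.comp (measurable_id.mul_const _)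
  rw [MeasureTheory.setLIntegral_congr_fun measurableSet_Ioi fun r hr => hw' r hr,
    MeasureTheory.lintegral_iSup' ]
  · congr 1
    ext n
    unfold weight
    rw [← MeasureTheory.lintegral_countable' (fun k => w (dyad n k)),
      MeasureTheory.lintegral_map (measurable_of_countable _) (hm n)]
    rfl
  · exact fun n => ((measurable_of_countable fun k => w (dyad n k)).comp (hm n)).aemeasurable
  · filter_upwards [MeasureTheory.ae_restrict_mem measurableSet_Ioi] with r hr
    exact fun m n hmn => hw (dyadAbove_anti hr hmn)

lemma superlevel_eq_iUnion (h : X → ℝ≥0∞) (hh : LowerSemicontinuous h) {r : ℝ} (hr : 0 < r) :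
    (superlevel h hh (ENNReal.ofReal r) : Set X) =
      ⋃ n, (superlevel h hh (ENNReal.ofReal (dyadAbove n r)) : Set X) := by
  ext x
  rw [mem_iUnion]
  change ENNReal.ofReal r < h x ↔ ∃ n, ENNReal.ofReal (dyadAbove n r) < h x
  constructor
  · intro hx
    obtain ⟨s, hs1, hs2⟩ := ENNReal.lt_iff_exists_nnreal_btwn.1 hx
    obtain ⟨n, hn⟩ := exists_dyadAbove_lt hr (s := (s : ℝ)) (by
      rw [← ENNReal.ofReal_coe_nnreal] at hs1
      exact (ENNReal.ofReal_lt_ofReal_iff_of_nonneg hr.le).1 hs1)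
    refine ⟨n, lt_of_le_of_lt ?_ hs2⟩
    rw [← ENNReal.ofReal_coe_nnreal]
    exact ENNReal.ofReal_le_ofReal hn.le
  · rintro ⟨n, hn⟩
    exact (ENNReal.ofReal_le_ofReal (lt_dyadAbove n r).le).trans_lt hn

lemma integral_eq_iSup_tsum (μ : PointContinuousValuation X) (h : X → ℝ≥0∞)
    (hh : LowerSemicontinuous h) : μ.integral h hh =
      ⨆ n, ∑' k, μ (superlevel h hh (ENNReal.ofReal (dyad n k))) * weight n k := by
  refine lintegral_eq_iSup_tsum _ (antitone_level μ h hh) fun r hr => ?_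
  refine μ.eq_iSup_of_monotone _ _ (fun m n hmn => ?_) (superlevel_eq_iUnion h hh hr)
  exact superlevel_mono hh hh le_rfl (ENNReal.ofReal_le_ofReal (dyadAbove_anti hr hmn))

lemma integral_dirac (x : X) (h : X → ℝ≥0∞) (hh : LowerSemicontinuous h) :
    (dirac x).integral h hh = h x := by
  have h1 : (dirac x).integral h hh =
      ∫⁻ r in Ioi (0 : ℝ), {r : ℝ | ENNReal.ofReal r < h x}.indicator 1 r := by
    refine MeasureTheory.lintegral_congr fun r => ?_
    by_cases hr : ENNReal.ofReal r < h x
    · have : x ∈ superlevel h hh (ENNReal.ofReal r) := hr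
      simp [dirac, this, hr]
    · have : x ∉ superlevel h hh (ENNReal.ofReal r) := hr
      simp [dirac, this, hr]
  have hmeas : MeasurableSet {r : ℝ | ENNReal.ofReal r < h x} :=
    measurableSet_lt ENNReal.measurable_ofReal measurable_const
  rw [h1, MeasureTheory.lintegral_indicator_one hmeas,
    MeasureTheory.Measure.restrict_apply hmeas]
  by_cases hx : h x = ⊤
  · simp [hx]
  · have : {r : ℝ | ENNReal.ofReal r < h x} ∩ Ioi 0 = Ioo 0 (h x).toReal := by
      ext r
      constructor
      · rintro ⟨h2, h3⟩
        exact ⟨h3, (ENNReal.ofReal_lt_iff_lt_toReal (le_of_lt h3) hx).1 h2⟩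
      · rintro ⟨h2, h3⟩
        exact ⟨(ENNReal.ofReal_lt_iff_lt_toReal h2.le hx).2 h3, h2⟩
    rw [this, Real.volume_Ioo, sub_zero, ENNReal.ofReal_toReal hx]

lemma lowerSemicontinuous_add_sum {f : X → ℝ≥0∞} (hf : LowerSemicontinuous f)
    (U : ℕ → Opens X) (c : ℕ → ℝ≥0∞) (K : ℕ) : LowerSemicontinuous fun x =>
      f x + ∑ k ∈ Finset.range K, (U k : Set X).indicator (fun _ => c k) x :=
  hf.add (lowerSemicontinuous_sum fun k _ => lowerSemicontinuous_indicator (U k) (c k))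

lemma integral_congr (μ : PointContinuousValuation X) {f g : X → ℝ≥0∞}
    (hf : LowerSemicontinuous f) (hg : LowerSemicontinuous g) (h : ∀ x, f x = g x) :
    μ.integral f hf = μ.integral g hg := by
  obtain rfl : f = g := funext h
  rfl

lemma integral_add_sum (μ : PointContinuousValuation X) {f : X → ℝ≥0∞}
    (hf : LowerSemicontinuous f) (U : ℕ → Opens X) (c : ℕ → ℝ≥0∞) (hc : ∀ k, c k ≠ ⊤) (K : ℕ) :
    μ.integral _ (lowerSemicontinuous_add_sum hf U c K) =
      μ.integral f hf + ∑ k ∈ Finset.range K, μ (U k) * c k := by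
  induction K with
  | zero =>
    simp only [Finset.range_zero, Finset.sum_empty, add_zero]
  | succ K ih =>
    rw [Finset.sum_range_succ, ← add_assoc, ← ih]
    by_cases h0 : c K = 0
    · rw [h0, mul_zero, add_zero]
      exact μ.integral_congr _ _ fun x => by simp [Finset.sum_range_succ, h0]
    · have e : ENNReal.ofReal (c K).toReal = c K := ENNReal.ofReal_toReal (hc K)
      have h1 := μ.integral_add_indicator _ (lowerSemicontinuous_add_sum hf U c K) (U K)
        (c K).toReal (ENNReal.toReal_pos h0 (hc K))
        ((lowerSemicontinuous_add_sum hf U c K).add (lowerSemicontinuous_indicator _ _))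
      rw [e, mul_comm] at h1
      rw [← h1]
      exact μ.integral_congr _ _ fun x => by rw [Finset.sum_range_succ, ← add_assoc]

lemma integral_add (μ : PointContinuousValuation X) {f g : X → ℝ≥0∞}
    (hf : LowerSemicontinuous f) (hg : LowerSemicontinuous g) :
    μ.integral (fun x => f x + g x) (hf.add hg) = μ.integral f hf + μ.integral g hg := by
  let U : ℕ → ℕ → Opens X := fun n k => superlevel g hg (ENNReal.ofReal (dyad n k))
  let D : ℕ → X → ℝ≥0∞ := fun n x => ∑' k, (U n k : Set X).indicator (fun _ => weight n k) x
  have hUmem : ∀ x (V : Opens X) (c : ℝ≥0∞),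
      (V : Set X).indicator (fun _ => c) x = dirac x V * c := by
    intro x V c
    by_cases hx : x ∈ V <;> simp [dirac, hx]
  have hD : ∀ n, LowerSemicontinuous (D n) := fun n =>
    lowerSemicontinuous_tsum fun k => lowerSemicontinuous_indicator _ _
  have hgD : ∀ x, g x = ⨆ n, D n x := by
    intro x
    rw [← integral_dirac x g hg, integral_eq_iSup_tsum]
    simp only [D, hUmem, U]
  have hDmono : Monotone D := by
    intro m n hmn x
    have key : ∀ n, D n x = ∫⁻ r in Ioi (0 : ℝ),
        dirac x (superlevel g hg (ENNReal.ofReal (dyadAbove n r))) := by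
      intro n
      have hm : Measurable fun r : ℝ => ⌊r * 2 ^ n⌋₊ :=
        Nat.measurable_floor.comp (measurable_id.mul_const _)
      simp only [D, hUmem, U]
      unfold weight
      rw [← MeasureTheory.lintegral_countable'
        (fun k => dirac x (superlevel g hg (ENNReal.ofReal (dyad n k)))),
        MeasureTheory.lintegral_map (measurable_of_countable _) hm]
      rfl
    rw [key, key]
    exact MeasureTheory.setLIntegral_mono' measurableSet_Ioi fun r hr =>
      (antitone_level (dirac x) g hg) (dyadAbove_anti hr hmn)
  rw [μ.integral_iSup _ (hf.add hg) (fun n x => f x + D n x) (fun n => hf.add (hD n))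
    (fun m n hmn x => add_le_add_right (hDmono hmn x) _)
    (fun x => by rw [hgD x, ENNReal.add_iSup])]
  rw [μ.integral_eq_iSup_tsum g hg, ENNReal.add_iSup]
  congr 1
  ext n
  rw [μ.integral_iSup _ (hf.add (hD n)) _
    (fun K => lowerSemicontinuous_add_sum hf (U n) (weight n) K)
    (fun K L hKL x => add_le_add_right (Finset.sum_le_sum_of_subset
      (Finset.range_mono hKL)) _)
    (fun x => by rw [← ENNReal.add_iSup, ← ENNReal.tsum_eq_iSup_nat])]
  rw [ENNReal.tsum_eq_iSup_nat, ENNReal.add_iSup]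
  congr 1
  ext K
  rw [integral_add_sum μ hf (U n) (weight n) (weight_ne_top n) K]

/-! ### The multiplication of the monad -/

/-- The multiplication `m_X : V_p (V_p X) → V_p X`, given by `m_X (Π) (U) = ∫ ν(U) dΠ(ν)`. -/
def join (P : PointContinuousValuation (PointContinuousValuation X)) :
    PointContinuousValuation X where
  toFun U := P.integral (fun ν => ν U) (lowerSemicontinuous_eval U)
  strict' := by
    rw [integral, MeasureTheory.lintegral_eq_zero_iff']
    · refine Filter.Eventually.of_forall fun r => ?_
      have : superlevel (fun ν : PointContinuousValuation X => ν ⊥) (lowerSemicontinuous_eval ⊥)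
          (ENNReal.ofReal r) = ⊥ := by
        ext ν
        change ENNReal.ofReal r < ν ⊥ ↔ False
        simp [ν.strict']
      change P (superlevel (fun ν : PointContinuousValuation X => ν ⊥) (lowerSemicontinuous_eval ⊥)
          (ENNReal.ofReal r)) = 0
      rw [this, P.strict']
    · exact (antitone_level P _ _).measurable.aemeasurable
  mono' := fun U V h => P.integral_mono _ _ fun ν => ν.mono' h
  modular' := fun U V => by
    rw [← P.integral_add, ← P.integral_add]
    exact P.integral_congr _ _ fun ν => ν.modular' U V
  pointContinuous' := by
    let _ := pointTopology X
    have h1 : ∀ r : ℝ≥0∞, LowerSemicontinuous fun U : Opens X =>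
        P (superlevel (fun ν : PointContinuousValuation X => ν U)
          (lowerSemicontinuous_eval U) r) := by
      intro r
      rw [pointContinuous_iff]
      intro U t ht
      obtain ⟨F, hF, hFU, hFV⟩ := P.exists_finite ht
      have h2 : ∀ ν : PointContinuousValuation X, ∃ G : Set X, ν ∈ F →
          G.Finite ∧ G ⊆ U ∧ ∀ V : Opens X, G ⊆ V → r < ν V := by
        intro ν
        by_cases hν : ν ∈ F
        · obtain ⟨G, hG⟩ := ν.exists_finite (show r < ν U from hFU hν)
          exact ⟨G, fun _ => hG⟩
        · exact ⟨∅, fun h => absurd h hν⟩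
      choose G hG using h2
      refine ⟨⋃ ν ∈ F, G ν, hF.biUnion fun ν hν => (hG ν hν).1,
        Set.iUnion₂_subset fun ν hν => (hG ν hν).2.1, fun V hV => hFV _ fun ν hν => ?_⟩
      exact (hG ν hν).2.2 V ((Set.subset_biUnion_of_mem (u := G) hν).trans hV)
    simp only [integral_eq_iSup_tsum]
    exact lowerSemicontinuous_iSup fun n => lowerSemicontinuous_tsum fun k =>
      (ENNReal.continuous_mul_const (weight_ne_top n k)).comp_lowerSemicontinuous (h1 _)
        fun a b h => mul_le_mul_left h _

end PointContinuousValuation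

/-! ### Algebras of the monad of point-continuous valuations -/

/-- A `V_p`-algebra on `X`: a continuous structure map `α : V_p X → X` with `α (δ_x) = x` and
`α ∘ m_X = α ∘ V_p α`. -/
structure VpAlgebra (X : Type*) [TopologicalSpace X] where
  str : C(PointContinuousValuation X, X)
  str_dirac : ∀ x : X, str (PointContinuousValuation.dirac x) = x
  str_join : ∀ P : PointContinuousValuation (PointContinuousValuation X),
    str P.join = str (P.map str)

/-- A continuous map `f` is a morphism of `V_p`-algebras if `f ∘ α = β ∘ V_p f`. -/
def IsVpAlgebraMorphism {X Y : Type*} [TopologicalSpace X] [TopologicalSpace Y]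
    (A : VpAlgebra X) (B : VpAlgebra Y) (f : C(X, Y)) : Prop :=
  ∀ μ : PointContinuousValuation X, f (A.str μ) = B.str (μ.map f)

/-! ### Topological cones -/

/-- A topological cone: a cone (a semimodule over `[0, ∞)`) with a `T₀` topology for which addition
and scalar multiplication are jointly continuous, where `[0, ∞)` carries its Scott topology, whose
proper nonempty open sets are the intervals `(r, ∞)`. -/
class IsTopologicalCone (C : Type*) [AddCommMonoid C] [Module ℝ≥0 C] [TopologicalSpace C] : Prop
    extends T0Space C, ContinuousAdd C where
  continuous_scott_smul :
    Continuous fun p : Topology.WithScott ℝ≥0 × C => Topology.WithScott.ofScott p.1 • p.2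

/-- Weak local convexity: every neighbourhood of a point contains a convex (not necessarily open)
neighbourhood of that point. -/
class IsWeaklyLocallyConvex (C : Type*) [AddCommMonoid C] [Module ℝ≥0 C] [TopologicalSpace C] :
    Prop where
  exists_convex : ∀ (x : C) (U : Set C), IsOpen U → x ∈ U →
    ∃ A : Set C, A ∈ nhds x ∧ Convex ℝ≥0 A ∧ A ⊆ U

/-- The cone structure `x + y = α (δ_x + δ_y)`, `r • x = α (r • δ_x)` induced by a `V_p`-algebra
`α` is the given cone structure of `C`. -/
structure VpAlgebra.InducesCone {C : Type*} [AddCommMonoid C] [Module ℝ≥0 C] [TopologicalSpace C]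
    (A : VpAlgebra C) : Prop where
  add_eq : ∀ x y : C,
    A.str (PointContinuousValuation.dirac x + PointContinuousValuation.dirac y) = x + y
  smul_eq : ∀ (r : ℝ≥0) (x : C), A.str (r • PointContinuousValuation.dirac x) = r • x

end

namespace PointContinuousValuation

variable {X Y : Type*} [TopologicalSpace X] [TopologicalSpace Y]

/-! The structure maps are linear: evaluating the associativity law at `δ_μ + δ_ν` and at `r • δ_μ`
turns the induced cone operations into `str_add` and `str_smul`. A morphism, tested on Dirac masses
and their combinations, is therefore linear. Conversely, for linear `f` the maps `f ∘ α` and `β ∘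
V_p f` agree on finite combinations of Dirac masses, and it remains to pass to arbitrary valuations.

This passage is `eq_of_eq_on_simple`. It rests on `exists_simple_le`: every basic neighbourhood of
`μ` contains a simple valuation below `μ`. Since open sets of valuations are upward closed, two
continuous maps that agree on simple valuations have values in the same open sets, and `T₀` makes
them equal.

The approximation is greedy. Point continuity reduces the mass of `U` to a finite set `F ⊆ U`; at
each point of `F` as much mass is placed as `μ` allows (`exists_saturated`), and modularity bounds
the remaining gap near `F`. Several open sets of finite mass are handled at once by rearranging them
into a chain and filling it from the smallest set outwards; sets of infinite mass are treated
afterwards. -/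

lemma add_apply (μ ν : PointContinuousValuation X) (U : Opens X) : (μ + ν) U = μ U + ν U := rfl

lemma smul_apply (r : ℝ≥0) (μ : PointContinuousValuation X) (U : Opens X) :
    (r • μ) U = (r : ℝ≥0∞) * μ U := rfl

lemma dirac_of_mem {x : X} {U : Opens X} (h : x ∈ U) : dirac x U = 1 := if_pos h

lemma dirac_of_notMem {x : X} {U : Opens X} (h : x ∉ U) : dirac x U = 0 := if_neg h

/-- The zero valuation. -/
instance : Zero (PointContinuousValuation X) where
  zero :=
    { toFun := fun _ => 0
      strict' := rfl
      mono' := fun _ _ _ => le_rfl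
      modular' := fun _ _ => by simp
      pointContinuous' := by
        rw [pointContinuous_iff]
        intro U r hr
        simp at hr }

lemma zero_apply (U : Opens X) : (0 : PointContinuousValuation X) U = 0 := rfl

lemma zero_smul_eq (μ : PointContinuousValuation X) : (0 : ℝ≥0) • μ = 0 := by
  ext U
  simp [smul_apply, zero_apply]

/-! ### Compatibility of the functor and the multiplication with the cone operations -/

lemma map_add (f : C(X, Y)) (μ ν : PointContinuousValuation X) :
    (μ + ν).map f = μ.map f + ν.map f := rfl

lemma map_smul (f : C(X, Y)) (r : ℝ≥0) (μ : PointContinuousValuation X) :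
    (r • μ).map f = r • μ.map f := rfl

lemma map_zero (f : C(X, Y)) : (0 : PointContinuousValuation X).map f = 0 := rfl

lemma map_dirac (f : C(X, Y)) (x : X) : (dirac x).map f = dirac (f x) := rfl

lemma continuous_map (f : C(X, Y)) :
    Continuous (fun μ : PointContinuousValuation X => μ.map f) := by
  refine continuous_generateFrom_iff.2 ?_
  rintro _ ⟨U, r, rfl⟩
  exact TopologicalSpace.isOpen_generateFrom_of_mem ⟨U.comap f, r, rfl⟩

lemma join_dirac (μ : PointContinuousValuation X) : (dirac μ).join = μ := by
  ext U
  exact integral_dirac μ _ (lowerSemicontinuous_eval U)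

/-- The integral is additive in the valuation because its integrand at each level is; antitone level
functions supply the measurability. -/
lemma join_add (P Q : PointContinuousValuation (PointContinuousValuation X)) :
    (P + Q).join = P.join + Q.join := by
  ext U
  exact MeasureTheory.lintegral_add_left
    (antitone_level P _ (lowerSemicontinuous_eval U)).measurable _

lemma join_smul (r : ℝ≥0) (P : PointContinuousValuation (PointContinuousValuation X)) :
    (r • P).join = r • P.join := by
  ext U
  exact MeasureTheory.lintegral_const_mul _
    (antitone_level P _ (lowerSemicontinuous_eval U)).measurable

/-! ### Simple valuations -/

/-- Simple valuations: finite linear combinations of Dirac masses. -/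
inductive IsSimple : PointContinuousValuation X → Prop
  | zero : IsSimple 0
  | add_smul_dirac {ν : PointContinuousValuation X} (h : IsSimple ν) (r : ℝ≥0) (x : X) :
      IsSimple (ν + r • dirac x)

/-- Finiteness is what allows values of simple valuations to be cancelled in `[0, ∞]`. -/
lemma IsSimple.ne_top {ν : PointContinuousValuation X} (h : IsSimple ν) (U : Opens X) :
    ν U ≠ ⊤ := by
  induction h with
  | zero => simp [zero_apply]
  | add_smul_dirac _ r x ih =>
    rw [add_apply, smul_apply]
    by_cases hx : x ∈ U
    · simpa [dirac_of_mem hx] using ih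
    · simpa [dirac_of_notMem hx] using ih

/-- If `μ` is almost equal to some `ν ≤ μ` on two open sets, then also on their union. -/
lemma lt_add_sup {μ ν : PointContinuousValuation X} (hν : ∀ U, ν U ≤ μ U) {V W : Opens X}
    {ε δ : ℝ≥0∞} (hV : μ V < ν V + ε) (hW : μ W < ν W + δ) :
    μ (V ⊔ W) < ν (V ⊔ W) + (ε + δ) := by
  -- The strict inequality `hV` forces `μ V < ∞`, so the intersection term can be cancelled after
  -- applying modularity.
  have hfin : μ (V ⊓ W) ≠ ⊤ := ((μ.mono' inf_le_left).trans_lt (hV.trans_le le_top)).ne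
  refine (ENNReal.add_lt_add_iff_right hfin).1 ?_
  calc μ (V ⊔ W) + μ (V ⊓ W) = μ V + μ W := (μ.modular' V W).symm
    _ < (ν V + ε) + (ν W + δ) := ENNReal.add_lt_add hV hW
    _ = ν V + ν W + (ε + δ) := by ring
    _ = ν (V ⊔ W) + ν (V ⊓ W) + (ε + δ) := by rw [ν.modular']
    _ ≤ ν (V ⊔ W) + μ (V ⊓ W) + (ε + δ) := by gcongr; exact hν _
    _ = ν (V ⊔ W) + (ε + δ) + μ (V ⊓ W) := by ring

/-- A simple valuation `ν ≤ μ` can be enlarged below `μ` by masses at the points of a finite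
`F ⊆ U`, until either the mass of `U` is large or `F` has a neighbourhood on which there is almost
no room left. -/
lemma exists_saturated (μ : PointContinuousValuation X) {ν : PointContinuousValuation X}
    (hs : IsSimple ν) (hν : ∀ V, ν V ≤ μ V) (U : Opens X) (R : ℝ≥0) (F : Finset X)
    (hF : (F : Set X) ⊆ U) (ε : ℝ≥0) (hε : 0 < ε) :
    ∃ ν' : PointContinuousValuation X, IsSimple ν' ∧ (∀ V, ν V ≤ ν' V) ∧ (∀ V, ν' V ≤ μ V) ∧
      ν' ⊤ + ν U = ν ⊤ + ν' U ∧
      ((R : ℝ≥0∞) < ν' U ∨ ∃ V : Opens X, (F : Set X) ⊆ V ∧ μ V < ν' V + ε) := by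
  classical
  induction F using Finset.induction_on generalizing ε with
  | empty =>
    refine ⟨ν, hs, fun _ => le_rfl, hν, rfl, Or.inr ⟨⊥, by simp, ?_⟩⟩
    rw [μ.strict']
    exact (ENNReal.coe_pos.2 hε).trans_le le_add_self
  | insert x F hx ih =>
    have hxU : x ∈ U := hF (by simp)
    obtain ⟨ν₁, hs₁, hle, hν₁, hmass, hcase⟩ :=
      ih (fun y hy => hF (by simp [Finset.mem_coe.1 hy])) (ε / 2) (by positivity)
    rcases hcase with hR | ⟨V₁, hFV₁, hV₁⟩
    · exact ⟨ν₁, hs₁, hle, hν₁, hmass, Or.inl hR⟩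
    -- `t` is the largest mass that can be added at `x` while staying below `μ`.
    set t : ℝ≥0∞ := ⨅ V : {V : Opens X // x ∈ V}, (μ V - ν₁ V) with ht
    have hadd : ∀ s : ℝ≥0, (s : ℝ≥0∞) ≤ t → ∀ V, (ν₁ + s • dirac x) V ≤ μ V := by
      intro s hst V
      rw [add_apply, smul_apply]
      by_cases hxV : x ∈ V
      · rw [dirac_of_mem hxV, mul_one, ← add_tsub_cancel_of_le (hν₁ V)]
        gcongr
        exact hst.trans (iInf_le (fun V : {V : Opens X // x ∈ V} => μ V - ν₁ V) ⟨V, hxV⟩)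
      · simpa [dirac_of_notMem hxV] using hν₁ V
    have hle' : ∀ (s : ℝ≥0) (V : Opens X), ν₁ V ≤ (ν₁ + s • dirac x) V := fun s V =>
      le_self_add
    -- Since `x ∈ U`, the total mass and the mass of `U` grow by the same amount.
    have hmass' : ∀ s : ℝ≥0,
        (ν₁ + s • dirac x) ⊤ + ν U = ν ⊤ + (ν₁ + s • dirac x) U := by
      intro s
      rw [add_apply, add_apply, smul_apply, smul_apply, dirac_of_mem hxU,
        dirac_of_mem (Opens.mem_top x), add_right_comm, hmass, add_assoc]
    -- With unlimited room at `x`, mass `R + 1` there already makes `U` large. Otherwise the full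
    -- mass `t` is placed at `x`, and the infimum yields a neighbourhood of `x` with less than `ε /
    -- 2` of room left.
    by_cases htop : t = ⊤
    · refine ⟨ν₁ + (R + 1) • dirac x, hs₁.add_smul_dirac _ _,
        fun V => (hle V).trans (hle' _ V), hadd _ (htop ▸ le_top), hmass' _, Or.inl ?_⟩
      rw [add_apply, smul_apply, dirac_of_mem hxU, mul_one]
      refine lt_of_lt_of_le ?_ le_add_self
      exact_mod_cast lt_add_one R
    · obtain ⟨s, hs⟩ : ∃ s : ℝ≥0, (s : ℝ≥0∞) = t := ⟨t.toNNReal, ENNReal.coe_toNNReal htop⟩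
      refine ⟨ν₁ + s • dirac x, hs₁.add_smul_dirac _ _,
        fun V => (hle V).trans (hle' _ V), hadd _ hs.le, hmass' _, Or.inr ?_⟩
      have hε2 : (0 : ℝ≥0∞) < ((ε / 2 : ℝ≥0) : ℝ≥0∞) := ENNReal.coe_pos.2 (by positivity)
      have hlt : t < t + ((ε / 2 : ℝ≥0) : ℝ≥0∞) := ENNReal.lt_add_right htop hε2.ne'
      obtain ⟨⟨V, hxV⟩, hV⟩ := iInf_lt_iff.1 (ht ▸ hlt)
      have hV2 : μ V < (ν₁ + s • dirac x) V + ((ε / 2 : ℝ≥0) : ℝ≥0∞) := by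
        rw [add_apply, smul_apply, dirac_of_mem hxV, mul_one, hs, add_assoc]
        calc μ V = ν₁ V + (μ V - ν₁ V) := (add_tsub_cancel_of_le (hν₁ V)).symm
          _ < ν₁ V + (t + ((ε / 2 : ℝ≥0) : ℝ≥0∞)) :=
            (ENNReal.add_lt_add_iff_left (hs₁.ne_top V)).2 (ht ▸ hV)
      have hV₁2 : μ V₁ < (ν₁ + s • dirac x) V₁ + ((ε / 2 : ℝ≥0) : ℝ≥0∞) :=
        hV₁.trans_le (by gcongr; exact hle' s V₁)
      refine ⟨V ⊔ V₁, ?_, ?_⟩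
      · intro y hy
        rcases Finset.mem_insert.1 (Finset.mem_coe.1 hy) with rfl | hy
        · exact Or.inl hxV
        · exact Or.inr (hFV₁ hy)
      · have := lt_add_sup (hadd s hs.le) hV2 hV₁2
        rwa [← ENNReal.coe_add, add_halves] at this

/-- A simple valuation `ν ≤ μ` can be enlarged by masses in `U`, below `μ`, such that the value at
`U` exceeds any number `r` with `r + ν (X \ U) < μ U`. -/
lemma exists_simple_extension (μ : PointContinuousValuation X) {ν : PointContinuousValuation X}
    (hs : IsSimple ν) (hν : ∀ V, ν V ≤ μ V) (U : Opens X) (r : ℝ≥0)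
    (hr : r + ν ⊤ < μ U + ν U) :
    ∃ ν' : PointContinuousValuation X, IsSimple ν' ∧ (∀ V, ν V ≤ ν' V) ∧ (∀ V, ν' V ≤ μ V) ∧
      ν' ⊤ + ν U = ν ⊤ + ν' U ∧ (r : ℝ≥0∞) < ν' U := by
  obtain ⟨ε, hε, hrε⟩ := ENNReal.lt_iff_exists_add_pos_lt.1 hr
  have hνU : ν U ≤ r + ν ⊤ + ε :=
    (ν.mono' le_top).trans (le_add_self.trans le_self_add)
  -- The truncated subtraction is a true one by `hνU`. This threshold is chosen so that `ν' V + ε`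
  -- above it gives `ν' U > r`.
  have hρ : r + ν ⊤ + ε - ν U < μ U := by
    refine (ENNReal.add_lt_add_iff_right (hs.ne_top U)).1 ?_
    rwa [tsub_add_cancel_of_le hνU]
  obtain ⟨F, hF, hFU, hFV⟩ := μ.exists_finite hρ
  obtain ⟨ν', hs', hle, hν', hmass, hcase⟩ :=
    exists_saturated μ hs hν U r hF.toFinset (by simpa using hFU) ε hε
  refine ⟨ν', hs', hle, hν', hmass, ?_⟩
  rcases hcase with h | ⟨V, hV, hμV⟩
  · exact h
  have h1 := (hFV V (by simpa using hV)).trans hμV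
  have h2 : r + ν ⊤ + ε < ν' V + ε + ν U := by
    rw [← tsub_add_cancel_of_le hνU]
    exact (ENNReal.add_lt_add_iff_right (hs.ne_top U)).2 h1
  -- `V` need not lie in `U`, so `ν' V` is bounded by the total mass; `hmass` says that no mass was
  -- added outside `U`.
  have h3 : ν' V + ε + ν U ≤ ν' U + ν ⊤ + ε := by
    calc ν' V + ε + ν U ≤ ν' ⊤ + ε + ν U := by gcongr; exact ν'.mono' le_top
      _ = ν' ⊤ + ν U + ε := by ring
      _ = ν' U + ν ⊤ + ε := by rw [hmass]; ring
  have h4 := h2.trans_le h3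
  rw [add_assoc, add_assoc] at h4
  exact (ENNReal.add_lt_add_iff_right
    (ENNReal.add_ne_top.2 ⟨hs.ne_top ⊤, ENNReal.coe_ne_top⟩)).1 h4

/-! ### Rearranging open sets into a chain -/

/-- Insert `U` into a decreasing list of open sets, preserving the sum of the indicators. -/
def chainInsert : Opens X → List (Opens X) → List (Opens X)
  | U, [] => [U]
  | U, V :: L => (V ⊔ U) :: chainInsert (V ⊓ U) L

/-- Each replacement of `V, U` by `V ⊔ U, V ⊓ U` preserves the sum by modularity. -/
lemma sum_chainInsert (μ : PointContinuousValuation X) (U : Opens X) (L : List (Opens X)) :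
    ((chainInsert U L).map μ).sum = μ U + (L.map μ).sum := by
  induction L generalizing U with
  | nil => simp [chainInsert]
  | cons V L ih =>
    simp only [chainInsert, List.map_cons, List.sum_cons, ih]
    rw [← add_assoc, ← μ.modular', add_comm (μ V), add_assoc]

lemma chainInsert_le {U W : Opens X} {L : List (Opens X)} (hU : U ≤ W) (hL : ∀ V ∈ L, V ≤ W) :
    ∀ V ∈ chainInsert U L, V ≤ W := by
  induction L generalizing U with
  | nil => simpa [chainInsert] using hU
  | cons V L ih =>
    intro V' hV'
    rcases List.mem_cons.1 hV' with rfl | h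
    · exact sup_le (hL V (by simp)) hU
    · exact ih (inf_le_right.trans hU) (fun V'' h'' => hL V'' (by simp [h''])) V' h

lemma pairwise_chainInsert (U : Opens X) (L : List (Opens X))
    (hL : L.Pairwise (fun V W => W ≤ V)) :
    (chainInsert U L).Pairwise (fun V W => W ≤ V) := by
  induction L generalizing U with
  | nil => simp [chainInsert]
  | cons V L ih =>
    rw [List.pairwise_cons] at hL
    refine List.pairwise_cons.2 ⟨?_, ih _ hL.2⟩
    exact chainInsert_le (inf_le_left.trans le_sup_left) fun W hW => (hL.1 W hW).trans le_sup_left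

lemma exists_chain (L : List (Opens X)) : ∃ K : List (Opens X),
    K.Pairwise (fun V W => W ≤ V) ∧ (∀ μ : PointContinuousValuation X,
      (K.map μ).sum = (L.map μ).sum) := by
  induction L with
  | nil => exact ⟨[], by simp, fun _ => rfl⟩
  | cons U L ih =>
    obtain ⟨K, hK, hsum⟩ := ih
    refine ⟨chainInsert U K, pairwise_chainInsert U K hK, fun μ => ?_⟩
    rw [sum_chainInsert, hsum, List.map_cons, List.sum_cons]

/-! ### Approximation by simple valuations from below -/

/-- The chain is filled from its smallest set outwards. The support clause records that all mass
placed so far lies in the next set `U`, so the condition for extending at `U` reduces to `r < μ U`.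
Later enlargements only improve the values at smaller sets. -/
lemma exists_simple_chain (μ : PointContinuousValuation X) (K : List (Opens X))
    (hK : K.Pairwise (fun V W => W ≤ V)) (hfin : (K.map μ).sum ≠ ⊤) (ε : ℝ≥0) (hε : 0 < ε) :
    ∃ ν : PointContinuousValuation X, IsSimple ν ∧ (∀ V, ν V ≤ μ V) ∧
      (∀ W, (∀ V ∈ K, V ≤ W) → ν ⊤ = ν W) ∧ (K.map μ).sum < (K.map ν).sum + ε := by
  induction K generalizing ε with
  | nil =>
    exact ⟨0, .zero, fun _ => bot_le, fun _ _ => rfl, by simpa using hε⟩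
  | cons U K ih =>
    rw [List.pairwise_cons] at hK
    rw [List.map_cons, List.sum_cons] at hfin
    obtain ⟨hU, hKfin⟩ := ENNReal.add_ne_top.1 hfin
    obtain ⟨ν, hs, hν, hsupp, hsum⟩ := ih hK.2 hKfin (ε / 2) (by positivity)
    have hνU := hsupp U hK.1
    have key : ∃ ν' : PointContinuousValuation X, IsSimple ν' ∧ (∀ V, ν V ≤ ν' V) ∧
        (∀ V, ν' V ≤ μ V) ∧ ν' ⊤ = ν' U ∧ μ U < ν' U + ((ε / 2 : ℝ≥0) : ℝ≥0∞) := by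
      have hε2 : (0 : ℝ≥0∞) < ((ε / 2 : ℝ≥0) : ℝ≥0∞) := ENNReal.coe_pos.2 (by positivity)
      -- For `μ U = 0` no `r` satisfies `r < μ U`, but `ν` itself suffices.
      by_cases h0 : μ U = 0
      · exact ⟨ν, hs, fun _ => le_rfl, hν, hνU, h0 ▸ hε2.trans_le le_add_self⟩
      obtain ⟨r, hr1, hr2⟩ := ENNReal.lt_iff_exists_nnreal_btwn.1
        (ENNReal.sub_lt_self hU h0 hε2.ne')
      obtain ⟨ν', hs', hle, hν', hmass, hr⟩ := exists_simple_extension μ hs hν U r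
        (by rw [hνU]; exact (ENNReal.add_lt_add_iff_right (hs.ne_top U)).2 hr2)
      refine ⟨ν', hs', hle, hν', ?_, ?_⟩
      -- As `ν` has no mass outside `U` and none was added there, `ν'` has none either.
      · rw [hνU, add_comm] at hmass
        exact (ENNReal.add_right_inj (hs.ne_top U)).1 hmass
      · exact (tsub_le_iff_right.1 hr1.le).trans_lt
          ((ENNReal.add_lt_add_iff_right ENNReal.coe_ne_top).2 hr)
    obtain ⟨ν', hs', hle, hν', hsupp', hμU⟩ := key
    refine ⟨ν', hs', hν', fun W hW => ?_, ?_⟩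
    · exact le_antisymm (hsupp'.le.trans (ν'.mono' (hW U (by simp)))) (ν'.mono' le_top)
    · have hmono : (K.map ν).sum ≤ (K.map ν').sum := List.sum_le_sum fun V _ => hle V
      calc ((U :: K).map μ).sum = μ U + (K.map μ).sum := by simp
        _ < (ν' U + ((ε / 2 : ℝ≥0) : ℝ≥0∞)) + ((K.map ν).sum + ((ε / 2 : ℝ≥0) : ℝ≥0∞)) :=
          ENNReal.add_lt_add hμU hsum
        _ ≤ (ν' U + ((ε / 2 : ℝ≥0) : ℝ≥0∞)) + ((K.map ν').sum + ((ε / 2 : ℝ≥0) : ℝ≥0∞)) := by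
          gcongr
        _ = ν' U + (K.map ν').sum + ((ε / 2 + ε / 2 : ℝ≥0) : ℝ≥0∞) := by
          rw [ENNReal.coe_add]; ring
        _ = ((U :: K).map ν').sum + ε := by rw [add_halves]; simp

/-- All the gaps between `ν` and `μ` are nonnegative, so a bound on their sum bounds each one. -/
lemma lt_add_of_sum_lt {μ ν : PointContinuousValuation X} (hν : ∀ V, ν V ≤ μ V)
    {L : List (Opens X)} {ε : ℝ≥0∞} (h : (L.map μ).sum < (L.map ν).sum + ε) :
    ∀ U ∈ L, μ U < ν U + ε := by
  induction L with
  | nil => simp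
  | cons V L ih =>
    rw [List.map_cons, List.map_cons, List.sum_cons, List.sum_cons] at h
    have hfin : μ V + (L.map μ).sum ≠ ⊤ := (h.trans_le le_top).ne
    obtain ⟨h1, h2⟩ := ENNReal.add_ne_top.1 hfin
    intro U hU
    rcases List.mem_cons.1 hU with rfl | hU
    · refine (ENNReal.add_lt_add_iff_right h2).1 (h.trans_le ?_)
      rw [add_right_comm]
      gcongr
      exact List.sum_le_sum fun V _ => hν V
    · refine ih ((ENNReal.add_lt_add_iff_left h1).1 (h.trans_le ?_)) U hU
      rw [add_assoc]
      gcongr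
      exact hν V

/-- The chain for `L` has the same sum under every valuation, so the total gap on the chain is the
total gap on `L`. -/
lemma exists_simple_of_finite (μ : PointContinuousValuation X) (L : List (Opens X))
    (hfin : ∀ U ∈ L, μ U ≠ ⊤) (ε : ℝ≥0) (hε : 0 < ε) :
    ∃ ν : PointContinuousValuation X, IsSimple ν ∧ (∀ V, ν V ≤ μ V) ∧
      ∀ U ∈ L, μ U < ν U + ε := by
  obtain ⟨K, hK, hsum⟩ := exists_chain L
  have hL : (L.map μ).sum ≠ ⊤ := by
    clear hsum
    induction L with
    | nil => simp
    | cons U L ih =>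
      rw [List.map_cons, List.sum_cons]
      exact ENNReal.add_ne_top.2 ⟨hfin U (by simp), ih fun V hV => hfin V (by simp [hV])⟩
  obtain ⟨ν, hs, hν, -, h⟩ := exists_simple_chain μ K hK (by rwa [hsum]) ε hε
  rw [hsum, hsum] at h
  exact ⟨ν, hs, hν, lt_add_of_sum_lt hν h⟩

/-- A simple valuation below `μ` can be enlarged so as to be large on given open sets of infinite
mass. -/
lemma exists_simple_of_top (μ : PointContinuousValuation X) {ν : PointContinuousValuation X}
    (hs : IsSimple ν) (hν : ∀ V, ν V ≤ μ V) (L : List (Opens X × ℝ≥0)) :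
    ∃ ν' : PointContinuousValuation X, IsSimple ν' ∧ (∀ V, ν V ≤ ν' V) ∧ (∀ V, ν' V ≤ μ V) ∧
      ∀ p ∈ L, μ p.1 = ⊤ → (p.2 : ℝ≥0∞) < ν' p.1 := by
  induction L with
  | nil => exact ⟨ν, hs, fun _ => le_rfl, hν, by simp⟩
  | cons p L ih =>
    obtain ⟨ν₁, hs₁, hle, hν₁, h⟩ := ih
    by_cases hp : μ p.1 = ⊤
    · obtain ⟨ν', hs', hle', hν', -, hr⟩ := exists_simple_extension μ hs₁ hν₁ p.1 p.2
        -- An infinite `μ U` satisfies the extension condition for every `r`, since the simple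
        -- valuation has finite total mass.
        (by
          rw [hp, top_add]
          exact (ENNReal.add_ne_top.2 ⟨ENNReal.coe_ne_top, hs₁.ne_top ⊤⟩).lt_top)
      refine ⟨ν', hs', fun V => (hle V).trans (hle' V), hν', fun q hq hqt => ?_⟩
      rcases List.mem_cons.1 hq with rfl | hq
      · exact hr
      · exact (h q hq hqt).trans_le (hle' _)
    · refine ⟨ν₁, hs₁, hle, hν₁, fun q hq hqt => ?_⟩
      rcases List.mem_cons.1 hq with rfl | hq
      · exact absurd hqt hp
      · exact h q hq hqt

/-- One `ε` for the whole list lets a single approximation within `ε` clear all thresholds. -/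
lemma exists_gap (μ : PointContinuousValuation X) (L : List (Opens X × ℝ≥0))
    (hL : ∀ p ∈ L, (p.2 : ℝ≥0∞) < μ p.1) :
    ∃ ε : ℝ≥0, 0 < ε ∧ ∀ p ∈ L, (p.2 : ℝ≥0∞) + ε ≤ μ p.1 := by
  induction L with
  | nil => exact ⟨1, one_pos, by simp⟩
  | cons p L ih =>
    obtain ⟨ε, hε, h⟩ := ih fun q hq => hL q (by simp [hq])
    obtain ⟨δ, hδ, h'⟩ := ENNReal.lt_iff_exists_add_pos_lt.1 (hL p (by simp))
    refine ⟨min ε δ, lt_min hε hδ, fun q hq => ?_⟩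
    rcases List.mem_cons.1 hq with rfl | hq
    · refine le_trans ?_ h'.le
      gcongr
      exact min_le_right _ _
    · refine le_trans ?_ (h q hq)
      gcongr
      exact min_le_left _ _

/-- Every point-continuous valuation is the supremum of the simple valuations below it, even
simultaneously on finitely many open sets. -/
theorem exists_simple_le (μ : PointContinuousValuation X) (L : List (Opens X × ℝ≥0))
    (hL : ∀ p ∈ L, (p.2 : ℝ≥0∞) < μ p.1) :
    ∃ ν : PointContinuousValuation X, IsSimple ν ∧ (∀ V, ν V ≤ μ V) ∧
      ∀ p ∈ L, (p.2 : ℝ≥0∞) < ν p.1 := by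
  classical
  obtain ⟨ε, hε, hgap⟩ := exists_gap μ L hL
  -- Sets of finite mass come first: the later enlargement for infinite mass only increases values,
  -- so their bounds survive.
  obtain ⟨ν₁, hs₁, hν₁, h₁⟩ := exists_simple_of_finite μ
    ((L.map Prod.fst).filter fun U => μ U ≠ ⊤) (by simp) ε hε
  obtain ⟨ν, hs, hle, hν, h⟩ := exists_simple_of_top μ hs₁ hν₁ L
  refine ⟨ν, hs, hν, fun p hp => ?_⟩
  by_cases hpt : μ p.1 = ⊤
  · exact h p hp hpt
  · have h2 := h₁ p.1 (List.mem_filter.2 ⟨List.mem_map_of_mem hp, by simpa using hpt⟩)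
    exact ((ENNReal.add_lt_add_iff_right ENNReal.coe_ne_top).1
      ((hgap p hp).trans_lt h2)).trans_le (hle _)

/-! ### Simple valuations determine continuous maps -/

lemma exists_basic_of_isOpen {W : Set (PointContinuousValuation X)} (hW : IsOpen W)
    {μ : PointContinuousValuation X} (hμ : μ ∈ W) :
    ∃ L : List (Opens X × ℝ≥0), (∀ p ∈ L, (p.2 : ℝ≥0∞) < μ p.1) ∧
      ∀ ν : PointContinuousValuation X, (∀ p ∈ L, (p.2 : ℝ≥0∞) < ν p.1) → ν ∈ W := by
  induction hW with
  | basic s hs =>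
    obtain ⟨U, r, rfl⟩ := hs
    exact ⟨[(U, r)], by simpa using hμ, fun ν h => h (U, r) (by simp)⟩
  | univ => exact ⟨[], by simp, fun _ _ => trivial⟩
  | inter s t _ _ ihs iht =>
    obtain ⟨L, hL, hLs⟩ := ihs hμ.1
    obtain ⟨K, hK, hKt⟩ := iht hμ.2
    refine ⟨L ++ K, fun p hp => (List.mem_append.1 hp).elim (hL p) (hK p), fun ν h => ⟨?_, ?_⟩⟩
    · exact hLs ν fun p hp => h p (List.mem_append_left _ hp)
    · exact hKt ν fun p hp => h p (List.mem_append_right _ hp)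
  | sUnion S _ ih =>
    obtain ⟨s, hs, hμs⟩ := hμ
    obtain ⟨L, hL, hLs⟩ := ih s hs hμs
    exact ⟨L, hL, fun ν h => ⟨s, hs, hLs ν h⟩⟩

/-- Basic open sets are given by lower bounds on values, which persist under enlargement. -/
lemma mem_of_le_of_isOpen {W : Set (PointContinuousValuation X)} (hW : IsOpen W)
    {ν μ : PointContinuousValuation X} (hν : ∀ V, ν V ≤ μ V) (h : ν ∈ W) : μ ∈ W := by
  obtain ⟨L, hL, hLW⟩ := exists_basic_of_isOpen hW h
  exact hLW μ fun p hp => (hL p hp).trans_le (hν _)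

/-- A simple `ν ≤ μ` inside `g⁻¹ O` lies in `h⁻¹ O` by agreement, and that open set is upward
closed. -/
lemma mem_of_mem_of_eq_on_simple {g h : PointContinuousValuation X → Y} (hg : Continuous g)
    (hh : Continuous h) (hgh : ∀ ν, IsSimple ν → g ν = h ν) (μ : PointContinuousValuation X)
    {O : Set Y} (hO : IsOpen O) (hμ : g μ ∈ O) : h μ ∈ O := by
  obtain ⟨L, hL, hLW⟩ := exists_basic_of_isOpen (hO.preimage hg) hμ
  obtain ⟨ν, hs, hν, hνL⟩ := exists_simple_le μ L hL
  have h1 : g ν ∈ O := hLW ν hνL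
  rw [hgh ν hs] at h1
  exact mem_of_le_of_isOpen (hO.preimage hh) hν h1

/-- Continuous maps into a `T₀` space that agree on the simple valuations are equal. -/
theorem eq_of_eq_on_simple [T0Space Y] {g h : PointContinuousValuation X → Y} (hg : Continuous g)
    (hh : Continuous h) (hgh : ∀ ν, IsSimple ν → g ν = h ν) (μ : PointContinuousValuation X) :
    g μ = h μ :=
  Inseparable.eq <| inseparable_iff_forall_isOpen.2 fun _ hO =>
    ⟨mem_of_mem_of_eq_on_simple hg hh hgh μ hO,
      mem_of_mem_of_eq_on_simple hh hg (fun ν hν => (hgh ν hν).symm) μ hO⟩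

end PointContinuousValuation

open PointContinuousValuation

/-! ### Linearity of the structure maps -/

namespace VpAlgebra

variable {C : Type*} [AddCommMonoid C] [Module ℝ≥0 C] [TopologicalSpace C]

lemma str_add {A : VpAlgebra C} (hA : A.InducesCone) (μ ν : PointContinuousValuation C) :
    A.str (μ + ν) = A.str μ + A.str ν := by
  -- Here `join` returns `μ + ν`, whereas pushing forward along `A.str` gives the sum of the Dirac
  -- masses at `A.str μ` and `A.str ν`.
  have h := A.str_join (dirac μ + dirac ν)
  rwa [join_add, join_dirac, join_dirac, PointContinuousValuation.map_add, map_dirac, map_dirac,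
    hA.add_eq] at h

lemma str_smul {A : VpAlgebra C} (hA : A.InducesCone) (r : ℝ≥0) (μ : PointContinuousValuation C) :
    A.str (r • μ) = r • A.str μ := by
  have h := A.str_join (r • dirac μ)
  rwa [join_smul, join_dirac, PointContinuousValuation.map_smul, map_dirac, hA.smul_eq] at h

lemma str_zero {A : VpAlgebra C} (hA : A.InducesCone) : A.str 0 = 0 := by
  rw [← zero_smul_eq (dirac (0 : C)), str_smul hA, zero_smul]

end VpAlgebra

/-! ### Morphisms and linear maps -/

theorem mainTheorem9 {X : Type*} {Y : Type*}
    [AddCommMonoid X] [Module ℝ≥0 X] [TopologicalSpace X]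
    [IsTopologicalCone X] [IsWeaklyLocallyConvex X] [QuasiSober X]
    [AddCommMonoid Y] [Module ℝ≥0 Y] [TopologicalSpace Y]
    [IsTopologicalCone Y] [IsWeaklyLocallyConvex Y] [QuasiSober Y]
    (A : VpAlgebra X) (hA : A.InducesCone) (B : VpAlgebra Y) (hB : B.InducesCone)
    (f : C(X, Y)) :
    IsVpAlgebraMorphism A B f ↔ IsLinearMap ℝ≥0 f := by
  constructor
  · intro h
    refine ⟨fun x y => ?_, fun r x => ?_⟩
    · rw [← hA.add_eq, h, PointContinuousValuation.map_add, map_dirac, map_dirac, hB.add_eq]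
    · rw [← hA.smul_eq, h, PointContinuousValuation.map_smul, map_dirac, hB.smul_eq]
  · intro h
    -- Both composites are continuous into a `T₀` space, so simple valuations suffice; there
    -- linearity of `f` and of both structure maps gives the equality by induction.
    refine eq_of_eq_on_simple (f.continuous.comp A.str.continuous)
      (B.str.continuous.comp (continuous_map f)) fun ν hν => ?_
    induction hν with
    | zero =>
      simp only [PointContinuousValuation.map_zero, VpAlgebra.str_zero hA,
        VpAlgebra.str_zero hB, h.map_zero]
    | add_smul_dirac _ r x ih =>
      rw [VpAlgebra.str_add hA, VpAlgebra.str_smul hA, A.str_dirac, h.map_add, h.map_smul, ih,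
        PointContinuousValuation.map_add, PointContinuousValuation.map_smul, map_dirac,
        VpAlgebra.str_add hB, VpAlgebra.str_smul hB, B.str_dirac]
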